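/- Let $G$ be a finite connected undirected graph, possibly with multiple edges and loops, with $n=|V(G)|\ge 1$ vertices. A partial orientation of $G$ is an orientation of a subset of the edges, the remaining edges being left unoriented; each edge, loops included, has two possible orientations. A directed cut of a partial orientation is a partition $(X, X^c)$ of $V(G)$ into two nonempty sets such that every edge of $G$ between $X$ and $X^c$ is oriented from $X$ to $X^c$; the corresponding cut reversal reverses all of these edges. Call two partial orientations equivalent if one can be obtained from the other by a sequence of cut reversals. Then the number of equivalence classes of partial orientations of $G$ is $$2^{n-1}\,T_G(1,3),$$ where $T_G(x,y)=\sum_{A\subseteq E(G)}(x-1)^{r(E(G))-r(A)}(y-1)^{|A|-r(A)}$ is the Tutte polynomial of $G$, with $r(A)=n-c(A)$ and $c(A)$ the number of connected components of the spanning subgraph $(V(G),A)$. -/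

import Mathlib

open scoped Graph

noncomputable section

namespace Graph

variable {α β : Type*}

/-- A multigraph is connected if it has a vertex and any two of its vertices are joined by a path. -/
def IsConnected (G : Graph α β) : Prop :=
  V(G).Nonempty ∧ ∀ x ∈ V(G), ∀ y ∈ V(G), Relation.ReflTransGen G.Adj x y

/-- The number of connected components of the spanning subgraph `(V(G), A)`. -/
def numComponents (G : Graph α β) (A : Set β) : ℕ :=
  Nat.card (Quot fun x y : V(G) => ∃ e ∈ A, G.IsLink e x y)

/-- The Tutte polynomial, by its subset expansion: the sum over the edge sets `A ⊆ E(G)` of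
`(x - 1) ^ (r(E) - r(A)) * (y - 1) ^ (|A| - r(A))`, where `r(A) = |V(G)| - c(A)` and `c(A)` is the
number of components of `(V(G), A)`. The variables are `x = X 0` and `y = X 1`. The exponents below
are these differences, and neither subtraction truncates, since `c(E) ≤ c(A)` and
`|V(G)| ≤ c(A) + |A|`. -/
def tuttePolynomial (G : Graph α β) [Finite E(G)] : MvPolynomial (Fin 2) ℤ :=
  ∑ A ∈ (Set.toFinite E(G)).toFinset.powerset,
    (MvPolynomial.X 0 - 1) ^ (G.numComponents A - G.numComponents E(G)) *
      (MvPolynomial.X 1 - 1) ^ (A.card + G.numComponents A - V(G).ncard)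

/-- A reference orientation: for each edge, one of its ends is named the tail and the other one
the head. (The two ends of a loop are the same vertex.) -/
structure ReferenceOrientation (G : Graph α β) where
  tail : E(G) → α
  head : E(G) → α
  isLink : ∀ e : E(G), G.IsLink e (tail e) (head e)

instance (G : Graph α β) : Nonempty G.ReferenceOrientation := by
  choose t h hth using fun e : E(G) => G.exists_isLink_of_mem_edgeSet e.2
  exact ⟨⟨t, h, hth⟩⟩

/-- A partial orientation, written relative to a reference orientation: the edge `e` is oriented as
in the reference (`1`), oppositely to the reference (`-1`), or is left unoriented (`0`). In
particular a loop, like every other edge, has two distinct orientations. -/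
abbrev PartialOrientation (G : Graph α β) : Type _ := E(G) → SignType

/-- In the partial orientation `O`, the edge `e` is oriented from `x` to `y`. -/
def ReferenceOrientation.Directs {G : Graph α β} (R : G.ReferenceOrientation)
    (O : G.PartialOrientation) (e : E(G)) (x y : α) : Prop :=
  (O e = 1 ∧ R.tail e = x ∧ R.head e = y) ∨ (O e = -1 ∧ R.tail e = y ∧ R.head e = x)

/-- The cut `(X, V(G) \ X)`: the set of edges with one end in `X` and the other one in
`V(G) \ X`. -/
def cutEdges (G : Graph α β) (X : Set α) : Set E(G) :=
  {e | ∃ x ∈ X, ∃ y ∈ V(G) \ X, G.IsLink e x y}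

/-- `(X, V(G) \ X)` is a directed cut of `O`: both sides are nonempty, and every edge between them
is oriented from `X` to `V(G) \ X` (so no edge of the cut is unoriented). -/
def ReferenceOrientation.IsDirectedCut {G : Graph α β} (R : G.ReferenceOrientation)
    (O : G.PartialOrientation) (X : Set α) : Prop :=
  X ⊆ V(G) ∧ X.Nonempty ∧ (V(G) \ X).Nonempty ∧
    ∀ e ∈ G.cutEdges X, ∃ x ∈ X, ∃ y ∈ V(G) \ X, R.Directs O e x y

open Classical in
/-- Reverse the oriented edges in the set `C`. -/
def PartialOrientation.reverseOn {G : Graph α β} (O : G.PartialOrientation) (C : Set E(G)) :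
    G.PartialOrientation :=
  fun e => if e ∈ C then -O e else O e

/-- `O'` arises from `O` by one cut reversal: all edges of some directed cut are reversed. -/
def ReferenceOrientation.CutReversal {G : Graph α β} (R : G.ReferenceOrientation)
    (O O' : G.PartialOrientation) : Prop :=
  ∃ X : Set α, R.IsDirectedCut O X ∧ O' = PartialOrientation.reverseOn O (G.cutEdges X)

/-- Two partial orientations are equivalent if they are related by a sequence of cut reversals. -/
def ReferenceOrientation.cutSetoid {G : Graph α β} (R : G.ReferenceOrientation) :
    Setoid G.PartialOrientation :=
  Relation.EqvGen.setoid R.CutReversal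

end Graph

end

/-! Fix a root `q` and call a partial orientation root-connected if every vertex is reached from `q`
along unoriented or forward edges. Each class contains exactly one of these. Existence: the
unreached vertices form the source side of a directed cut, and reversing it enlarges the reached set
(`exists_cutReversal`). Uniqueness: equivalent states differ by twice a coboundary, and reachability
makes the potential constant (`eq_of_potential`).

To count them, edges are converted one at a time from directed to undirected behaviour by a
bijection preserving the reached set (`card_reaching_eq`). Once all are converted, an edge is closed
in one state and open in two, so the count is the sum of `2 ^ |A|` over connected spanning `A`. At
`x = 1` only these `A` survive in the Tutte polynomial, each with weight `2 ^ (|A| - n + 1)`. -/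

open Relation Function

/-! ### Reachability from a root, and potentials -/

section Reachability

variable {V : Type*}

/-- The relation `r` with the pair `(t, h)` added if `f` holds and the pair `(h, t)` added if `b`
holds. -/
def addArcs (r : V → V → Prop) (t h : V) (f b : Prop) (x y : V) : Prop :=
  r x y ∨ (f ∧ x = t ∧ y = h) ∨ (b ∧ x = h ∧ y = t)

theorem reflTransGen_of_closed {r r' : V → V → Prop} {q : V}
    (H : ∀ x y, ReflTransGen r q x → r' x y → ReflTransGen r q y) {v : V}
    (hv : ReflTransGen r' q v) : ReflTransGen r q v := by
  induction hv with
  | refl => exact .refl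
  | tail _ hs ih => exact H _ _ ih hs

theorem reflTransGen_addArcs_of_reflTransGen {r : V → V → Prop} {q t h v : V} {f b : Prop}
    (hv : ReflTransGen r q v) : ReflTransGen (addArcs r t h f b) q v :=
  ReflTransGen.mono (fun _ _ hs => Or.inl hs) _ _ hv

/-- An arc into an already reached vertex adds nothing, so its presence may be changed freely. -/
theorem reflTransGen_addArcs_of_tail {r : V → V → Prop} {q t h : V}
    (ht : ReflTransGen r q t) {f b b' : Prop} {v : V}
    (hv : ReflTransGen (addArcs r t h f b) q v) : ReflTransGen (addArcs r t h f b') q v := by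
  refine reflTransGen_of_closed (fun x y hx hs => ?_) hv
  rcases hs with hs | hs | ⟨_, rfl, rfl⟩
  · exact hx.tail (Or.inl hs)
  · exact hx.tail (Or.inr (Or.inl hs))
  · exact reflTransGen_addArcs_of_reflTransGen ht

theorem reflTransGen_addArcs_of_head {r : V → V → Prop} {q t h : V}
    (hh : ReflTransGen r q h) {f f' b : Prop} {v : V}
    (hv : ReflTransGen (addArcs r t h f b) q v) : ReflTransGen (addArcs r t h f' b) q v := by
  refine reflTransGen_of_closed (fun x y hx hs => ?_) hv
  rcases hs with hs | ⟨_, rfl, rfl⟩ | hs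
  · exact hx.tail (Or.inl hs)
  · exact reflTransGen_addArcs_of_reflTransGen hh
  · exact hx.tail (Or.inr (Or.inr hs))

theorem reflTransGen_of_reflTransGen_addArcs {r : V → V → Prop} {q t h : V}
    (ht : ¬ ReflTransGen r q t) (hh : ¬ ReflTransGen r q h) {f b : Prop} {v : V}
    (hv : ReflTransGen (addArcs r t h f b) q v) : ReflTransGen r q v := by
  refine reflTransGen_of_closed (fun x y hx hs => ?_) hv
  rcases hs with hs | ⟨_, rfl, rfl⟩ | ⟨_, rfl, rfl⟩
  · exact hx.tail hs
  · exact absurd hx ht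
  · exact absurd hx hh

variable {E : Type*} (t h : E → V)

/-- Passing from `x` to `y` along the edge `e`, with ends `t e` and `h e`, in the state `O`. An edge
outside `D` can be passed in its direction, and both ways if it is unoriented; an edge in `D` can be
passed both ways or not at all, the latter in the state `-1`. -/
def Passes (D : Set E) (O : E → SignType) (e : E) (x y : V) : Prop :=
  (O e ≠ -1 ∧ x = t e ∧ y = h e) ∨
    (((e ∈ D ∧ O e ≠ -1) ∨ (e ∉ D ∧ O e ≠ 1)) ∧ x = h e ∧ y = t e)

/-- One can pass from `x` to `y` along some edge. -/
def Step (D : Set E) (O : E → SignType) (x y : V) : Prop :=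
  ∃ e, Passes t h D O e x y

/-- One can pass from `x` to `y` along some edge other than `e`. -/
def StepAvoiding (D : Set E) (e : E) (O : E → SignType) (x y : V) : Prop :=
  ∃ e' ≠ e, Passes t h D O e' x y

theorem step_eq_addArcs (D : Set E) (O : E → SignType) (e : E) :
    Step t h D O = addArcs (StepAvoiding t h D e O) (t e) (h e) (O e ≠ -1)
      ((e ∈ D ∧ O e ≠ -1) ∨ (e ∉ D ∧ O e ≠ 1)) := by
  ext x y
  constructor
  · rintro ⟨e', he'⟩
    by_cases hee : e' = e
    · subst hee; exact Or.inr he'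
    · exact Or.inl ⟨e', hee, he'⟩
  · rintro (⟨e', -, he'⟩ | hs)
    · exact ⟨e', he'⟩
    · exact ⟨e, hs⟩

theorem stepAvoiding_insert (D : Set E) (O : E → SignType) (e : E) :
    StepAvoiding t h (insert e D) e O = StepAvoiding t h D e O := by
  ext x y
  refine exists_congr fun e' => and_congr_right fun hne => ?_
  simp [Passes, hne]

open Classical in
theorem stepAvoiding_update (D : Set E) (O : E → SignType) (e : E) (s : SignType) :
    StepAvoiding t h D e (update O e s) = StepAvoiding t h D e O := by
  ext x y
  refine exists_congr fun e' => and_congr_right fun hne => ?_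
  simp [Passes, hne]

open Classical in
/-- Flip the edge `e` unless its end `t e` is reached without it. -/
noncomputable def flipUnlessTail (q : V) (D : Set E) (e : E) (O : E → SignType) : E → SignType :=
  if ReflTransGen (StepAvoiding t h D e O) q (t e) then O else update O e (-O e)

theorem flipUnlessTail_involutive (q : V) (D : Set E) (e : E) :
    Involutive (flipUnlessTail t h q D e) := by
  classical
  intro O
  by_cases ht : ReflTransGen (StepAvoiding t h D e O) q (t e)
  · simp [flipUnlessTail, ht]
  · simp [flipUnlessTail, ht, stepAvoiding_update]

/-- If the tail is reached without `e`, only the forward arc matters, and it is open for `O e ≠ -1`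
in both models. If only the head is, the backward arc matters: it is open for `O e ≠ 1` when
directed and for state `≠ -1` when undirected, and negation exchanges the two. If neither end is
reached, `e` is useless. -/
theorem reflTransGen_step_insert_flipUnlessTail (q : V) {D : Set E} {e : E} (he : e ∉ D)
    (O : E → SignType) (v : V) :
    ReflTransGen (Step t h (insert e D) (flipUnlessTail t h q D e O)) q v ↔
      ReflTransGen (Step t h D O) q v := by
  classical
  rw [step_eq_addArcs t h _ _ e, step_eq_addArcs t h D O e, stepAvoiding_insert]
  unfold flipUnlessTail
  split_ifs with ht
  · exact ⟨reflTransGen_addArcs_of_tail ht, reflTransGen_addArcs_of_tail ht⟩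
  · rw [stepAvoiding_update]
    by_cases hh : ReflTransGen (StepAvoiding t h D e O) q (h e)
    · have hb : ((e ∈ insert e D ∧ update O e (-O e) e ≠ -1) ∨
          (e ∉ insert e D ∧ update O e (-O e) e ≠ 1)) =
            ((e ∈ D ∧ O e ≠ -1) ∨ (e ∉ D ∧ O e ≠ 1)) := by
        simp [he]
      rw [hb]
      exact ⟨reflTransGen_addArcs_of_head hh, reflTransGen_addArcs_of_head hh⟩
    · exact ⟨fun hv => reflTransGen_addArcs_of_reflTransGen
          (reflTransGen_of_reflTransGen_addArcs ht hh hv),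
        fun hv => reflTransGen_addArcs_of_reflTransGen
          (reflTransGen_of_reflTransGen_addArcs ht hh hv)⟩

/-- The number of states for which all of `U` is reached from `q` does not depend on the set `D` of
edges that are treated as undirected. -/
theorem card_reaching_eq [Finite E] (q : V) (U : Set V) (D : Set E) :
    Nat.card {O : E → SignType // ∀ v ∈ U, ReflTransGen (Step t h D O) q v} =
      Nat.card {O : E → SignType // ∀ v ∈ U, ReflTransGen (Step t h ∅ O) q v} := by
  induction D, D.toFinite using Set.Finite.induction_on with
  | empty => rfl
  | @insert e D he _ ih =>
    rw [← ih]
    refine (Nat.card_congr ((flipUnlessTail_involutive t h q D e).toPerm.subtypeEquiv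
      fun O => ?_)).symm
    simp [reflTransGen_step_insert_flipUnlessTail t h q he]

/-- If all of `U` is reached from `q` in the state `O`, and `O` differs from another state by twice
the coboundary of `f`, then `f` is maximal at `q`. -/
theorem potential_le_of_reflTransGen {q : V} {U : Set V} (hU : U.Finite) (hq : q ∈ U)
    (htU : ∀ e, t e ∈ U) (hhU : ∀ e, h e ∈ U) {O O' : E → SignType}
    (hO : ∀ v ∈ U, ReflTransGen (Step t h ∅ O) q v) (f : V → ℤ)
    (hf : ∀ e, (O e : ℤ) - (O' e : ℤ) = 2 * (f (t e) - f (h e))) :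
    ∀ v ∈ U, f v ≤ f q := by
  obtain ⟨m, hm, hmax⟩ := hU.exists_maximalFor f U ⟨q, hq⟩
  have hmax' : ∀ v ∈ U, f v ≤ f m := fun v hv => by
    rcases le_total (f v) (f m) with hle | hle
    · exact hle
    · exact hmax hv hle
  -- Maximality of `f` propagates backwards along a path from `q`.
  have key : ∀ v, ReflTransGen (Step t h ∅ O) q v → f v = f m → f q = f m := by
    intro v hv
    induction hv with
    | refl => exact id
    | @tail x y _ hs ih =>
      intro hy
      apply ih
      obtain ⟨e, ⟨he, rfl, rfl⟩ | ⟨he, rfl, rfl⟩⟩ := hs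
      · have h1 := hmax' _ (htU e)
        have h2 := hf e
        have h3 : (0 : ℤ) ≤ (O e : ℤ) := by
          revert he; generalize O e = s; cases s <;> simp
        have h4 : (O' e : ℤ) ≤ 1 := by generalize O' e = s; cases s <;> simp
        -- The difference of states is at least `-1` and even, hence nonnegative: `f` cannot
        -- increase along a passable edge.
        omega
      · have h1 := hmax' _ (hhU e)
        have h2 := hf e
        have h3 : (O e : ℤ) ≤ 0 := by
          revert he; generalize O e = s; cases s <;> simp
        have h4 : -1 ≤ (O' e : ℤ) := by generalize O' e = s; cases s <;> simp
        omega
  rw [key m (hO m hm) rfl]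
  exact hmax'

/-- Two states in which all of `U` is reached from `q` agree if they differ by twice a coboundary. -/
theorem eq_of_potential {q : V} {U : Set V} (hU : U.Finite) (hq : q ∈ U)
    (htU : ∀ e, t e ∈ U) (hhU : ∀ e, h e ∈ U) {O O' : E → SignType}
    (hO : ∀ v ∈ U, ReflTransGen (Step t h ∅ O) q v)
    (hO' : ∀ v ∈ U, ReflTransGen (Step t h ∅ O') q v) (f : V → ℤ)
    (hf : ∀ e, (O e : ℤ) - (O' e : ℤ) = 2 * (f (t e) - f (h e))) : O = O' := by
  have h1 := potential_le_of_reflTransGen t h hU hq htU hhU hO f hf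
  have h2 := potential_le_of_reflTransGen t h hU hq htU hhU (O' := O) hO' (fun v => -f v)
    fun e => by linarith [hf e]
  have h3 : ∀ v ∈ U, f v = f q := fun v hv => le_antisymm (h1 v hv) (by linarith [h2 v hv])
  ext e
  have h4 := hf e
  rw [h3 _ (htU e), h3 _ (hhU e)] at h4
  revert h4
  generalize O e = s
  generalize O' e = s'
  cases s <;> cases s' <;> simp

end Reachability

namespace Graph

variable {α β : Type*} {G : Graph α β}

/-! ### Root-connected representatives of the classes -/

namespace ReferenceOrientation

variable (R : G.ReferenceOrientation)

theorem tail_mem (e : E(G)) : R.tail e ∈ V(G) := (R.isLink e).left_mem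

theorem head_mem (e : E(G)) : R.head e ∈ V(G) := (R.isLink e).right_mem

theorem mem_cutEdges_iff {X : Set α} {e : E(G)} :
    e ∈ G.cutEdges X ↔
      (R.tail e ∈ X ∧ R.head e ∉ X) ∨ (R.head e ∈ X ∧ R.tail e ∉ X) := by
  constructor
  · rintro ⟨x, hx, y, hy, hl⟩
    rcases (R.isLink e).eq_and_eq_or_eq_and_eq hl with ⟨h1, h2⟩ | ⟨h1, h2⟩
    · exact Or.inl ⟨h1 ▸ hx, h2 ▸ hy.2⟩
    · exact Or.inr ⟨h2 ▸ hx, h1 ▸ hy.2⟩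
  · rintro (⟨h1, h2⟩ | ⟨h1, h2⟩)
    · exact ⟨_, h1, _, ⟨R.head_mem e, h2⟩, R.isLink e⟩
    · exact ⟨_, h1, _, ⟨R.tail_mem e, h2⟩, (R.isLink e).symm⟩

/-- Every vertex of `G` can be reached from `q` along edges that are unoriented or oriented
forwards. -/
def IsRootConnected (q : α) (O : G.PartialOrientation) : Prop :=
  ∀ v ∈ V(G), ReflTransGen (Step R.tail R.head ∅ O) q v

theorem CutReversal.exists_potential {O O' : G.PartialOrientation} (h : R.CutReversal O O') :
    ∃ f : α → ℤ, ∀ e, (O e : ℤ) - (O' e : ℤ) = 2 * (f (R.tail e) - f (R.head e)) := by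
  classical
  obtain ⟨X, ⟨-, -, -, hX⟩, rfl⟩ := h
  -- The potential is the indicator of the source side; reversing `±1` changes a state by `2`.
  refine ⟨fun v => if v ∈ X then 1 else 0, fun e => ?_⟩
  by_cases he : e ∈ G.cutEdges X
  · obtain ⟨x, hx, y, hy, ⟨h1, rfl, rfl⟩ | ⟨h1, rfl, rfl⟩⟩ := hX e he
    · simp [PartialOrientation.reverseOn, he, h1, hx, hy.2]
    · simp [PartialOrientation.reverseOn, he, h1, hx, hy.2]
  · have hX' : R.tail e ∈ X ↔ R.head e ∈ X := by
      rw [R.mem_cutEdges_iff] at he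
      tauto
    simp [PartialOrientation.reverseOn, he, hX']

theorem exists_potential_of_eqvGen {O O' : G.PartialOrientation} (h : EqvGen R.CutReversal O O') :
    ∃ f : α → ℤ, ∀ e, (O e : ℤ) - (O' e : ℤ) = 2 * (f (R.tail e) - f (R.head e)) := by
  induction h with
  | rel _ _ h => exact CutReversal.exists_potential R h
  | refl => exact ⟨0, by simp⟩
  | symm _ _ _ ih =>
    obtain ⟨f, hf⟩ := ih
    exact ⟨-f, fun e => by simp only [Pi.neg_apply]; linarith [hf e]⟩
  | trans _ _ _ _ _ ih ih' =>
    obtain ⟨f, hf⟩ := ih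
    obtain ⟨f', hf'⟩ := ih'
    exact ⟨f + f', fun e => by simp only [Pi.add_apply]; linarith [hf e, hf' e]⟩

theorem eq_of_eqvGen_of_isRootConnected [Finite V(G)] {q : α} (hq : q ∈ V(G))
    {O O' : G.PartialOrientation} (h : EqvGen R.CutReversal O O') (hO : R.IsRootConnected q O)
    (hO' : R.IsRootConnected q O') : O = O' := by
  obtain ⟨f, hf⟩ := R.exists_potential_of_eqvGen h
  exact eq_of_potential R.tail R.head (Set.toFinite V(G)) hq R.tail_mem R.head_mem hO hO' f hf

/-- Reversing the cut between the vertices that are not reached from `q` and the vertices that are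
makes the set of reached vertices larger. -/
theorem exists_cutReversal (hG : G.IsConnected) {q : α} (hq : q ∈ V(G))
    {O : G.PartialOrientation} (hO : ¬ R.IsRootConnected q O) :
    ∃ O', R.CutReversal O O' ∧
      {v ∈ V(G) | ¬ ReflTransGen (Step R.tail R.head ∅ O') q v} ⊂
        {v ∈ V(G) | ¬ ReflTransGen (Step R.tail R.head ∅ O) q v} := by
  classical
  set X := {v ∈ V(G) | ¬ ReflTransGen (Step R.tail R.head ∅ O) q v} with hXdef
  have reached : ∀ v ∈ V(G), v ∉ X → ReflTransGen (Step R.tail R.head ∅ O) q v :=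
    fun v hv hvX => by_contra fun hn => hvX ⟨hv, hn⟩
  have hqX : q ∉ X := fun h => h.2 .refl
  have out : ∀ e, R.tail e ∈ X → R.head e ∉ X → O e = 1 := fun e ht hh => by
    by_contra hne
    exact ht.2 ((reached _ (R.head_mem e) hh).tail ⟨e, Or.inr ⟨Or.inr ⟨id, hne⟩, rfl, rfl⟩⟩)
  have into : ∀ e, R.head e ∈ X → R.tail e ∉ X → O e = -1 := fun e hh ht => by
    by_contra hne
    exact hh.2 ((reached _ (R.tail_mem e) ht).tail ⟨e, Or.inl ⟨hne, rfl, rfl⟩⟩)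
  obtain ⟨x, hxV, hx⟩ : ∃ x ∈ V(G), ¬ ReflTransGen (Step R.tail R.head ∅ O) q x := by
    simpa [IsRootConnected] using hO
  have hcut : R.IsDirectedCut O X := by
    refine ⟨fun v hv => hv.1, ⟨x, hxV, hx⟩, ⟨q, hq, hqX⟩, fun e he => ?_⟩
    rcases R.mem_cutEdges_iff.1 he with ⟨h1, h2⟩ | ⟨h1, h2⟩
    · exact ⟨_, h1, _, ⟨R.head_mem e, h2⟩, Or.inl ⟨out e h1 h2, rfl, rfl⟩⟩
    · exact ⟨_, h1, _, ⟨R.tail_mem e, h2⟩, Or.inr ⟨into e h1 h2, rfl, rfl⟩⟩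
  refine ⟨_, ⟨X, hcut, rfl⟩, ?_⟩
  set O' := PartialOrientation.reverseOn O (G.cutEdges X) with hO'
  have keep : ∀ v, ReflTransGen (Step R.tail R.head ∅ O) q v →
      ReflTransGen (Step R.tail R.head ∅ O') q v := by
    intro v hv
    induction hv with
    | refl => exact .refl
    | @tail y z hy hs ih =>
      have hyX : y ∉ X := fun h => h.2 hy
      have hzX : z ∉ X := fun h => h.2 (hy.tail hs)
      obtain ⟨e, he⟩ := hs
      have hec : e ∉ G.cutEdges X := by
        rw [R.mem_cutEdges_iff]
        rcases he with ⟨-, rfl, rfl⟩ | ⟨-, rfl, rfl⟩ <;> tauto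
      have hOe : O' e = O e := by simp [hO', PartialOrientation.reverseOn, hec]
      refine ih.tail ⟨e, ?_⟩
      simpa only [Passes, hOe] using he
  have cross : ∀ v, ReflTransGen G.Adj q v → v ∈ X → ∃ u w, u ∉ X ∧ w ∈ X ∧ G.Adj u w := by
    intro v hv
    induction hv with
    | refl => exact fun h => absurd h hqX
    | @tail y z _ ha ih =>
      intro hz
      by_cases hy : y ∈ X
      · exact ih hy
      · exact ⟨y, z, hy, hz, ha⟩
  -- Connectivity makes the cut nonempty; after reversal its edge `e` leads from the reached `u` to
  -- the new vertex `w`.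
  obtain ⟨u, w, hu, hw, e, hl⟩ := cross x (hG.2 q hq x hxV) ⟨hxV, hx⟩
  have hsub : {v ∈ V(G) | ¬ ReflTransGen (Step R.tail R.head ∅ O') q v} ⊆ X :=
    fun v hv => ⟨hv.1, fun h => hv.2 (keep v h)⟩
  refine (Set.ssubset_iff_of_subset hsub).2 ⟨w, hw, ?_⟩
  rintro ⟨-, hw'⟩
  apply hw'
  have hu' := keep u (reached u hl.left_mem hu)
  have hec : (⟨e, hl.edge_mem⟩ : E(G)) ∈ G.cutEdges X := ⟨w, hw, u, ⟨hl.left_mem, hu⟩, hl.symm⟩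
  have hOe : O' ⟨e, hl.edge_mem⟩ = -O ⟨e, hl.edge_mem⟩ := by
    simp [hO', PartialOrientation.reverseOn, hec]
  refine hu'.tail ⟨⟨e, hl.edge_mem⟩, ?_⟩
  rcases (R.isLink ⟨e, hl.edge_mem⟩).eq_and_eq_or_eq_and_eq hl with ⟨h1, h2⟩ | ⟨h1, h2⟩
  · refine Or.inl ⟨?_, h1.symm, h2.symm⟩
    rw [hOe, into _ (by rwa [h2]) (by rwa [h1])]
    decide
  · refine Or.inr ⟨Or.inr ⟨id, ?_⟩, h2.symm, h1.symm⟩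
    rw [hOe, out _ (by rwa [h1]) (by rwa [h2])]
    decide

theorem exists_isRootConnected [Finite V(G)] (hG : G.IsConnected) {q : α} (hq : q ∈ V(G))
    (O : G.PartialOrientation) : ∃ O', EqvGen R.CutReversal O O' ∧ R.IsRootConnected q O' := by
  induction hn : {v ∈ V(G) | ¬ ReflTransGen (Step R.tail R.head ∅ O) q v}.ncard
    using Nat.strong_induction_on generalizing O with
  | _ n ih =>
    by_cases hO : R.IsRootConnected q O
    · exact ⟨O, .refl _, hO⟩
    · obtain ⟨O₁, h₁, hlt⟩ := R.exists_cutReversal hG hq hO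
      obtain ⟨O₂, h₂, hO₂⟩ := ih _
        (hn ▸ Set.ncard_lt_ncard hlt ((Set.toFinite V(G)).subset fun v hv => hv.1)) O₁ rfl
      exact ⟨O₂, .trans _ _ _ (.rel _ _ h₁) h₂, hO₂⟩

/-- Every equivalence class contains exactly one partial orientation in which all vertices are
reached from a given root. -/
theorem card_quotient_cutSetoid [Finite V(G)] (hG : G.IsConnected) {q : α} (hq : q ∈ V(G)) :
    Nat.card (Quotient R.cutSetoid) = Nat.card {O // R.IsRootConnected q O} := by
  refine (Nat.card_eq_of_bijective
    (fun O : {O // R.IsRootConnected q O} => Quotient.mk R.cutSetoid O.1) ⟨?_, ?_⟩).symm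
  · intro O O' h
    exact Subtype.ext (R.eq_of_eqvGen_of_isRootConnected hq (Quotient.exact h) O.2 O'.2)
  · intro c
    induction c using Quotient.inductionOn with
    | h O =>
      obtain ⟨O', h, hO'⟩ := R.exists_isRootConnected hG hq O
      exact ⟨⟨O', hO'⟩, (Quotient.sound h).symm⟩

end ReferenceOrientation

/-! ### Connected spanning subgraphs and the Tutte polynomial -/

theorem numComponents_eq_one_iff {q : α} (hq : q ∈ V(G)) (A : Set β) :
    G.numComponents A = 1 ↔
      ∀ v ∈ V(G), ReflTransGen (fun x y => ∃ e ∈ A, G.IsLink e x y) q v := by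
  rw [numComponents, Nat.card_eq_one_iff_unique]
  constructor
  · rintro ⟨hs, -⟩ v hv
    have h := Quot.eqvGen_exact (hs.elim (Quot.mk _ ⟨q, hq⟩) (Quot.mk _ ⟨v, hv⟩))
    have hsymm : Std.Symm (fun x y => ∃ e ∈ A, G.IsLink e x y) :=
      ⟨fun _ _ ⟨e, he, hl⟩ => ⟨e, he, hl.symm⟩⟩
    have key : ∀ x y : V(G), EqvGen (fun x y : V(G) => ∃ e ∈ A, G.IsLink e x y) x y →
        ReflTransGen (fun x y => ∃ e ∈ A, G.IsLink e x y) (x : α) y := by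
      intro x y hxy
      induction hxy with
      | rel _ _ h => exact .single h
      | refl => exact .refl
      | symm _ _ _ ih => exact symm ih
      | trans _ _ _ _ _ ih ih' => exact ih.trans ih'
    exact key _ _ h
  · intro h
    have key : ∀ v, ReflTransGen (fun x y => ∃ e ∈ A, G.IsLink e x y) q v → ∀ hv : v ∈ V(G),
        Quot.mk (fun x y : V(G) => ∃ e ∈ A, G.IsLink e x y) ⟨q, hq⟩ = Quot.mk _ ⟨v, hv⟩ := by
      intro v hv
      induction hv with
      | refl => exact fun _ => rfl
      | tail _ hs ih =>
        obtain ⟨e, he, hl⟩ := hs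
        exact fun hv => (ih hl.left_mem).trans (Quot.sound ⟨e, he, hl⟩)
    refine ⟨⟨fun a b => ?_⟩, ⟨Quot.mk _ ⟨q, hq⟩⟩⟩
    induction a using Quot.ind with | _ a
    induction b using Quot.ind with | _ b
    exact (key _ (h a a.2) a.2).symm.trans (key _ (h b b.2) b.2)

theorem IsConnected.numComponents_edgeSet (hG : G.IsConnected) : G.numComponents E(G) = 1 := by
  obtain ⟨q, hq⟩ := hG.1
  rw [numComponents_eq_one_iff hq]
  exact fun v hv => ReflTransGen.mono (fun _ _ ⟨e, hl⟩ => ⟨e, hl.edge_mem, hl⟩) _ _ (hG.2 q hq v hv)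

theorem numComponents_pos [Finite V(G)] (hV : V(G).Nonempty) (A : Set β) :
    0 < G.numComponents A := by
  obtain ⟨q, hq⟩ := hV
  have : Nonempty (Quot fun x y : V(G) => ∃ e ∈ A, G.IsLink e x y) := ⟨Quot.mk _ ⟨q, hq⟩⟩
  exact Nat.card_pos

theorem ncard_vertexSet_le_of_numComponents_eq_one {q : α} (hq : q ∈ V(G)) (A : Finset β)
    (hA : G.numComponents A = 1) : V(G).ncard ≤ A.card + 1 := by
  rw [numComponents_eq_one_iff hq] at hA
  -- Dropping loops and merging parallel edges keeps connectivity, and the edges of `H` inject into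
  -- `A`.
  let H : SimpleGraph V(G) := SimpleGraph.fromRel fun x y => ∃ e ∈ A, G.IsLink e x y
  have hreach : ∀ v, ReflTransGen (fun x y => ∃ e ∈ (A : Set β), G.IsLink e x y) q v →
      ∀ hv : v ∈ V(G), H.Reachable ⟨q, hq⟩ ⟨v, hv⟩ := by
    intro v hv
    induction hv with
    | refl => exact fun _ => .refl _
    | @tail y z _ hs ih =>
      obtain ⟨e, he, hl⟩ := hs
      intro hz
      by_cases hyz : y = z
      · subst hyz; exact ih hz
      · refine (ih hl.left_mem).trans (SimpleGraph.Adj.reachable ?_)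
        exact ⟨fun h => hyz (congrArg Subtype.val h), Or.inl ⟨e, he, hl⟩⟩
  have hconn : H.Connected := by
    have : Nonempty V(G) := ⟨⟨q, hq⟩⟩
    exact ⟨fun a b => (hreach a (hA a a.2) a.2).symm.trans (hreach b (hA b b.2) b.2)⟩
  have hedge : ∀ s : H.edgeSet, ∃ e : A, ∃ x y : V(G), s.1 = s(x, y) ∧ G.IsLink e x y := by
    rintro ⟨s, hs⟩
    induction s using Sym2.ind with | _ x y
    obtain ⟨-, ⟨e, he, hl⟩ | ⟨e, he, hl⟩⟩ := hs
    · exact ⟨⟨e, he⟩, x, y, rfl, hl⟩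
    · exact ⟨⟨e, he⟩, x, y, rfl, hl.symm⟩
  choose φ hφ using hedge
  have hinj : Injective φ := by
    intro s s' hss
    obtain ⟨x, y, h1, h2⟩ := hφ s
    obtain ⟨x', y', h1', h2'⟩ := hφ s'
    rw [← hss] at h2'
    refine Subtype.ext ?_
    rw [h1, h1', Sym2.eq_iff]
    simpa only [Subtype.ext_iff] using h2.eq_and_eq_or_eq_and_eq h2'
  have h1 := hconn.card_vert_le_card_edgeSet_add_one
  have h2 := Nat.card_le_card_of_injective φ hinj
  rw [Nat.card_eq_finsetCard] at h2
  rw [Nat.card_coe_set_eq] at h1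
  omega

theorem ReferenceOrientation.reaching_univ_iff (R : G.ReferenceOrientation) {q : α} (hq : q ∈ V(G))
    (O : G.PartialOrientation) :
    (∀ v ∈ V(G), ReflTransGen (Step R.tail R.head Set.univ O) q v) ↔
      G.numComponents (Subtype.val '' {e : E(G) | O e ≠ -1}) = 1 := by
  rw [numComponents_eq_one_iff hq]
  have : Step R.tail R.head Set.univ O =
      fun x y => ∃ e ∈ (Subtype.val '' {e : E(G) | O e ≠ -1}), G.IsLink e x y := by
    ext x y
    constructor
    · rintro ⟨e, ⟨he, rfl, rfl⟩ | ⟨he, rfl, rfl⟩⟩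
      · exact ⟨e, ⟨e, he, rfl⟩, R.isLink e⟩
      · exact ⟨e, ⟨e, by simpa using he, rfl⟩, (R.isLink e).symm⟩
    · rintro ⟨_, ⟨e, he, rfl⟩, hl⟩
      refine ⟨e, ?_⟩
      rcases (R.isLink e).eq_and_eq_or_eq_and_eq hl with ⟨h1, h2⟩ | ⟨h1, h2⟩
      · exact Or.inl ⟨he, h1.symm, h2.symm⟩
      · exact Or.inr ⟨Or.inl ⟨trivial, he⟩, h2.symm, h1.symm⟩
  rw [this]

open Classical in
/-- The number of states of the edges in which the edges other than those in the state `-1` form a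
set with the property `P`. -/
theorem card_image_val_support (S : Set β) [Finite S] (P : Set β → Prop) :
    Nat.card {O : S → SignType // P (Subtype.val '' {e : S | O e ≠ -1})} =
      ∑ A ∈ (Set.toFinite S).toFinset.powerset, if P A then 2 ^ A.card else 0 := by
  have := Fintype.ofFinite S
  let supp : (S → SignType) → Finset β := fun O =>
    (Finset.univ.filter fun e => O e ≠ -1).map (Embedding.subtype _)
  have hsupp : ∀ O, Subtype.val '' {e : S | O e ≠ -1} = (supp O : Set β) := fun O => by
    simp [supp]
  simp only [hsupp]
  rw [Nat.card_eq_fintype_card, Fintype.card_subtype,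
    Finset.card_eq_sum_card_fiberwise (f := supp) (t := (Set.toFinite S).toFinset.powerset)]
  swap
  · intro O _
    simp only [Finset.coe_powerset, Set.mem_preimage, Set.mem_powerset_iff, Finset.coe_subset]
    intro b hb
    simp only [supp, Finset.mem_map] at hb
    obtain ⟨e, -, rfl⟩ := hb
    simp
  refine Finset.sum_congr rfl fun A hA => ?_
  have hAS : ∀ b ∈ A, b ∈ S := fun b hb => by simpa using Finset.mem_powerset.1 hA hb
  rw [Finset.filter_filter]
  split_ifs with hP
  -- The fibre over `A` is a product: two choices on `A`, one off it.
  · have hfib : (Finset.univ.filter fun O : S → SignType => P (supp O) ∧ supp O = A) =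
        Fintype.piFinset fun e : S => if (e : β) ∈ A then {0, 1} else {-1} := by
      ext O
      simp only [Finset.mem_filter, Finset.mem_univ, true_and, Fintype.mem_piFinset]
      constructor
      · rintro ⟨-, rfl⟩ e
        have : (e : β) ∈ supp O ↔ O e ≠ -1 := by simp [supp]
        simp only [this]
        generalize O e = s
        cases s <;> simp
      · intro h
        have hA' : supp O = A := by
          ext b
          simp only [supp, Finset.mem_map, Finset.mem_filter, Finset.mem_univ, true_and]
          constructor
          · rintro ⟨e, he, rfl⟩
            by_contra hn
            have := h e
            rw [if_neg (show (e : β) ∉ A from hn)] at this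
            exact he (by simpa using this)
          · intro hb
            refine ⟨⟨b, hAS b hb⟩, ?_, rfl⟩
            have := h ⟨b, hAS b hb⟩
            rw [if_pos hb] at this
            rintro h'
            rw [h'] at this
            simp at this
        exact ⟨hA' ▸ hP, hA'⟩
    rw [hfib, Fintype.card_piFinset]
    have hcard : ∀ e : S, (if (e : β) ∈ A then {0, 1} else {-1} : Finset SignType).card =
        if (e : β) ∈ A then 2 else 1 := fun e => by split_ifs <;> rfl
    simp only [hcard]
    rw [Finset.prod_ite, Finset.prod_const, Finset.prod_const_one, mul_one]
    congr 1
    rw [← Finset.card_map (Embedding.subtype _)]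
    congr 1
    ext b
    simp only [Finset.mem_map, Finset.mem_filter, Finset.mem_univ, true_and]
    exact ⟨fun ⟨e, he, h⟩ => h ▸ he, fun hb => ⟨⟨b, hAS b hb⟩, hb, rfl⟩⟩
  · rw [Finset.card_eq_zero, Finset.filter_eq_empty_iff]
    rintro O - ⟨h, rfl⟩
    exact hP h

open Classical in
theorem two_pow_mul_eval_tuttePolynomial [Finite V(G)] [Finite E(G)] (hG : G.IsConnected) :
    2 ^ (V(G).ncard - 1) * MvPolynomial.eval ![1, 3] G.tuttePolynomial =
      ∑ A ∈ (Set.toFinite E(G)).toFinset.powerset,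
        if G.numComponents A = 1 then (2 : ℤ) ^ A.card else 0 := by
  obtain ⟨q, hq⟩ := hG.1
  have hn : 0 < V(G).ncard := (Set.ncard_pos (Set.toFinite _)).2 ⟨q, hq⟩
  rw [tuttePolynomial, map_sum, Finset.mul_sum]
  refine Finset.sum_congr rfl fun A _ => ?_
  have hpos := numComponents_pos hG.1 (A : Set β)
  rw [hG.numComponents_edgeSet]
  simp only [map_mul, map_pow, map_sub, MvPolynomial.eval_X, map_one, Matrix.cons_val_zero,
    Matrix.cons_val_one, sub_self]
  split_ifs with hA
  · have hle := ncard_vertexSet_le_of_numComponents_eq_one hq A hA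
    rw [hA, Nat.sub_self, pow_zero, one_mul]
    norm_num
    rw [← pow_add]
    congr 1
    -- `hle` rules out truncation in `|A| + 1 - n`.
    omega
  -- The exponent `c(A) - 1` is nonzero because `c(A)` is positive and not `1`.
  · rw [zero_pow (by omega), zero_mul, mul_zero]

end Graph

theorem theorem5 {α β : Type*} (G : Graph α β) [Finite V(G)] [Finite E(G)]
    (hG : G.IsConnected) (R : G.ReferenceOrientation) :
    (Nat.card (Quotient R.cutSetoid) : ℤ) =
      2 ^ (V(G).ncard - 1) * MvPolynomial.eval ![1, 3] G.tuttePolynomial := by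
  classical
  obtain ⟨q, hq⟩ := hG.1
  rw [G.two_pow_mul_eval_tuttePolynomial hG, R.card_quotient_cutSetoid hG hq]
  unfold Graph.ReferenceOrientation.IsRootConnected
  rw [← card_reaching_eq R.tail R.head q V(G) Set.univ]
  simp only [R.reaching_univ_iff hq]
  rw [Graph.card_image_val_support E(G) fun A => G.numComponents A = 1]
  push_cast
  rfl
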